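/- **Setting.** Let $\nu,\nu^\star$ be probability measures on $\mathbb R^n$ and let $h_0,h_1,h_1^\star:\mathbb R^n\to\mathbb R^n$ be measurable. Put $\mu_0=(h_0)_\#\nu$, $\mu_1=(h_1)_\#\nu$, $\mu_0^\star=(h_0)_\#\nu^\star$, $\mu_1^\star=(h_1^\star)_\#\nu^\star$ and $\mu_1^\dagger=(h_1)_\#\nu^\star$. **Terminology.** A measure is *supported on* a convex set $K$ if $K$ carries all its mass and every point of $K$ lies in its topological support; it is supported on a finite set $F$ if $F$ carries all its mass. Maps $h,g:\mathbb R^n\to\mathbb R^n$ are *co-monotone* if $\langle h(x)-h(y),g(x)-g(y)\rangle\ge 0$ for all $x,y$, and $g\circ h^{-1}$ is *well defined* if $h(x)=h(y)$ implies $g(x)=g(y)$. A map $T$ is *cyclically monotone* on $K$ if $\sum_{i=1}^m\|u_i-T(u_i)\|^2\le\sum_{i=1}^m\|u_i-T(u_{i+1})\|^2$ for all $m\ge1$ and all $u_1,\dots,u_m\in K$, $u_{m+1}=u_1$. The *Brenier map* from $P$ to $Q$ is the $P$-almost everywhere unique map which is $P$-almost everywhere the gradient of a convex function $\varphi:\mathbb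 R^n\to\mathbb R\cup\{+\infty\}$ and pushes $P$ forward to $Q$. **Assumptions.** - (A.1) $\mu_0$ and $\mu_0^\star$ are absolutely continuous with respect to Lebesgue measure and supported on convex sets $K_0$ and $K_0^\star$, respectively. - (A.2) $\mu_1$ and $\mu_1^\dagger$ are supported on finite sets $F_1$ and $F_1^\dagger$, respectively. - (A.3) $h_0$ and $h_1$ are co-monotone and $h_1\circ h_0^{-1}$ is well defined. - (A.4) $h_0$ and $h_1^\star$ are co-monotone and $h_1^\star\circ h_0^{-1}$ is well defined. - (A.5) $\mu_1^\star$ is absolutely continuous with respect to Lebesgue measure and supported on a convex set $K_1^\star$. **Theorem.** (1) Under (A.1)–(A.3) there is a map $\mathsf d$ on $\mathbb R^n$ with $\mathsf d\circ h_0=h_1$ $\nu$-a.e. and $\nu^\star$-a.e. (that is, $\mathsf d=h_1\circ h_0^{-1}$) such that - $\mathsf d$ maps $K_0^\star$ into $F_1^\dagger$, is cyclically monotone on $K_0^\star$, and $\mu_1^\dagger=\mathsf d_\#\mu_0^\star$; every map with these three properties equals $\mathsf d$ $\mu_0^\star$-a.e., and $\mathsf d$ is the Brenier map from $\mu_0^\star$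 to $\mu_1^\dagger$; - $\mathsf d$ is the Brenier map from $\mu_0$ to $\mu_1$; moreover, if $\varphi$ is convex, finite and differentiable at $\mu_0$-almost every point (finite in a neighbourhood of it), and $(\nabla\varphi)_\#\mu_0=\mu_1$, then $\nabla\varphi=\mathsf d$ also $\mu_0^\star$-a.e. on $K_0$. (2) If in addition (A.4)–(A.5) hold, there is a map $\mathsf T$ on $\mathbb R^n$ that maps $K_1^\star$ into $F_1^\dagger$, is cyclically monotone on $K_1^\star$ and satisfies $\mu_1^\dagger=\mathsf T_\#\mu_1^\star$; every map with these three properties equals $\mathsf T$ $\mu_1^\star$-a.e., and $\mathsf T$ is the Brenier map from $\mu_1^\star$ to $\mu_1^\dagger$. -/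

import Mathlib

open MeasureTheory Set
open scoped Gradient

/-- The Euclidean space `ℝⁿ`. -/
abbrev Rn (n : ℕ) : Type := EuclideanSpace ℝ (Fin n)

/-- `h` and `g` are co-monotone: `⟨h x - h y, g x - g y⟩ ≥ 0` for all `x`, `y`. -/
def CoMonotone {n : ℕ} (h g : Rn n → Rn n) : Prop :=
  ∀ x y, 0 ≤ inner ℝ (h x - h y) (g x - g y)

/-- `g ∘ h⁻¹` is a well-defined function on the range of `h`. -/
def CompInvWellDefined {n : ℕ} (g h : Rn n → Rn n) : Prop :=
  ∀ x y, h x = h y → g x = g y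

/-- `μ` is supported on `K`: `K` carries all the mass of `μ` and every point of `K` belongs to the
topological support of `μ` (so that `K` is the support of `μ`, up to taking closures). -/
def IsSupportedOn {n : ℕ} (μ : Measure (Rn n)) (K : Set (Rn n)) : Prop :=
  μ Kᶜ = 0 ∧ K ⊆ μ.support

/-- `T` is cyclically monotone on `S`: along every cycle `u₀, …, uₘ, u₀` of points of `S`, matching
each `uᵢ` with `T uᵢ` costs no more than matching it with `T uᵢ₊₁`. (Addition in `Fin (m + 1)` is
cyclic.) -/
def CyclicallyMonotoneOn {n : ℕ} (T : Rn n → Rn n) (S : Set (Rn n)) : Prop :=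
  ∀ (m : ℕ) (u : Fin (m + 1) → Rn n), (∀ i, u i ∈ S) →
    ∑ i, ‖u i - T (u i)‖ ^ 2 ≤ ∑ i, ‖u i - T (u (i + 1))‖ ^ 2

/-- The convex function `φ` with effective domain `C` (understood as `+∞` outside `C`) is
differentiable `P`-almost everywhere, and its gradient pushes `P` forward to `Q`. -/
def IsBrenierPotential {n : ℕ} (P Q : Measure (Rn n)) (C : Set (Rn n)) (φ : Rn n → ℝ) : Prop :=
  ConvexOn ℝ C φ ∧ (∀ᵐ x ∂P, x ∈ interior C ∧ DifferentiableAt ℝ φ x) ∧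
    AEMeasurable (∇ φ) P ∧ P.map (∇ φ) = Q

/-- `T` is, up to a `P`-null set, the gradient of a convex function that pushes `P` to `Q`. -/
def IsGradientTransport {n : ℕ} (P Q : Measure (Rn n)) (T : Rn n → Rn n) : Prop :=
  ∃ (C : Set (Rn n)) (φ : Rn n → ℝ), IsBrenierPotential P Q C φ ∧ T =ᵐ[P] ∇ φ

/-- `T` is the Brenier map from `P` to `Q`: the `P`-almost everywhere unique gradient of a convex
function that pushes `P` forward to `Q`. -/
def IsBrenierMap {n : ℕ} (P Q : Measure (Rn n)) (T : Rn n → Rn n) : Prop :=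
  IsGradientTransport P Q T ∧ ∀ S, IsGradientTransport P Q S → S =ᵐ[P] T

/-- `T` maps `K` into `F`, is cyclically monotone on `K` and pushes `P` forward to `Q`. -/
def IsMonotoneTransportOn {n : ℕ} (P Q : Measure (Rn n)) (K F : Set (Rn n))
    (T : Rn n → Rn n) : Prop :=
  MapsTo T K F ∧ CyclicallyMonotoneOn T K ∧ AEMeasurable T P ∧ P.map T = Q

/-! The central notion is a slope potential: weights `c` for which `T x` is, at each `x`, a maximal
slope among the affine functions `⟪a, ·⟫ + c a`, with `a` running over the values of `T`. If the
values are finitely many, such a `T` is almost everywhere the gradient of a maximum of affine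
functions, since ties lie on hyperplanes. It is also cyclically monotone, and complementary
slackness (`IsSlopePotentialOn.ae_eq`) shows that its law determines it almost everywhere. Every
claim thus becomes a matter of finding slope potentials.

Co-monotonicity only gives monotonicity of pairs. On a convex set, for finitely many values, this
suffices: the map is locally a selection of subgradients, so its circulation vanishes around small
triangles, and by subdivision around all of them (`MintyMonotoneOn.segmentIntegral_triangle`).
Integration from a base point then gives a potential.

The drift `h1 ∘ h0⁻¹` is prescribed only on the range of `h0`, and its values are in the finite set
only almost surely, while the theorem speaks of every point of the convex set. So `d x` is chosen as
a value `a` in the finite set with `x` in the closure of `h0 '' (h1 ⁻¹' {a})`. Full support makes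
the choice possible, monotonicity survives closure, and almost everywhere only one value is
compatible with the graph; hence `d ∘ h0 = h1` almost surely. Near almost every point of `K0` the
drift is constant, so a Brenier potential is affine on a dense subset of a neighbourhood, hence on
the neighbourhood. This carries the gradient identity over to the treated law.

For the second part, minimising the semidiscrete Kantorovich dual gives weights whose cells have the
prescribed masses. -/

open Filter Topology AffineMap

/-! ### Potentials of monotone maps with finite range. -/

section Potential

variable {E : Type*} [NormedAddCommGroup E] [InnerProductSpace ℝ E]

/-- At every point `x` of `S`, among the affine functions `⟪T y, ·⟫ + c (T y)` with `y ∈ S`, the one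
with slope `T x` is maximal. -/
def IsSlopePotentialOn (T : E → E) (c : E → ℝ) (S : Set E) : Prop :=
  ∀ x ∈ S, ∀ y ∈ S, inner ℝ (T y) x + c (T y) ≤ inner ℝ (T x) x + c (T x)

/-- `T` is monotone on `S` in the sense of Minty. -/
def MintyMonotoneOn (T : E → E) (S : Set E) : Prop :=
  ∀ x ∈ S, ∀ y ∈ S, 0 ≤ inner ℝ (x - y) (T x - T y)

/-- A selection of subgradients of a function admits a slope potential (the negative of the
conjugate function). -/
theorem exists_isSlopePotentialOn_of_subgradient {T : E → E} {S : Set E} {φ : E → ℝ}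
    (h : ∀ x ∈ S, ∀ y ∈ S, φ x + inner ℝ (T x) (y - x) ≤ φ y) :
    ∃ c, IsSlopePotentialOn T c S ∧ ∀ x ∈ S, c (T x) = φ x - inner ℝ (T x) x := by
  classical
  have key : ∀ x ∈ S, ∀ y ∈ S, T x = T y → φ x - inner ℝ (T x) x = φ y - inner ℝ (T y) y := by
    intro x hx y hy hxy
    have h1 := h x hx y hy
    have h2 := h y hy x hx
    rw [inner_sub_right] at h1 h2
    rw [hxy] at h1 ⊢
    linarith
  choose! p hpS hpT using fun a (ha : a ∈ T '' S) => ha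
  have hc : ∀ x ∈ S, φ (p (T x)) - inner ℝ (T x) (p (T x)) = φ x - inner ℝ (T x) x := by
    intro x hx
    have hm : T x ∈ T '' S := mem_image_of_mem T hx
    have := key (p (T x)) (hpS _ hm) x hx (hpT _ hm)
    rwa [hpT _ hm] at this
  refine ⟨fun a => φ (p a) - inner ℝ a (p a), fun x hx y hy => ?_, hc⟩
  simp only [hc x hx, hc y hy]
  have := h y hy x hx
  rw [inner_sub_right] at this
  linarith

/-- A map of finite range that is monotone on `K` is locally the gradient of a convex function. -/
theorem MintyMonotoneOn.exists_ball_inner_nonneg {d : E → E} {K : Set E}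
    (hd : MintyMonotoneOn d K) (hfin : (d '' K).Finite) (x : E) :
    ∃ r > 0, ∀ y ∈ K, ∀ z ∈ K, z ∈ Metric.ball x r → 0 ≤ inner ℝ (d y - d z) (y - x) := by
  -- As the range is finite, the only values taken near `x` are those whose fibre has `x` in its
  -- closure.
  have hev : ∀ᶠ z in 𝓝 x, ∀ b ∈ d '' K, x ∉ closure (K ∩ d ⁻¹' {b}) →
      z ∉ closure (K ∩ d ⁻¹' {b}) := by
    rw [eventually_all_finite hfin]
    intro b _
    by_cases hx : x ∈ closure (K ∩ d ⁻¹' {b})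
    · exact Eventually.of_forall fun z hz => absurd hx hz
    · filter_upwards [isClosed_closure.isOpen_compl.mem_nhds hx] with z hz _ using hz
  obtain ⟨r, hr, hball⟩ := Metric.eventually_nhds_iff_ball.1 hev
  refine ⟨r, hr, fun y hy z hz hzr => ?_⟩
  have hx : x ∈ closure (K ∩ d ⁻¹' {d z}) := by
    by_contra hx
    exact hball z hzr (d z) (mem_image_of_mem d hz) hx (subset_closure ⟨hz, rfl⟩)
  have hcl : IsClosed {w | 0 ≤ inner ℝ (d y - d z) (y - w)} :=
    isClosed_le continuous_const (by fun_prop)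
  refine closure_minimal ?_ hcl hx
  rintro w ⟨hw, hwz⟩
  have := hd y hy w hw
  rw [mem_singleton_iff.1 hwz, real_inner_comm] at this
  exact this

/-- The integral of the vector field `d` along the segment from `x` to `y`. -/
noncomputable def segmentIntegral (d : E → E) (x y : E) : ℝ :=
  ∫ t in (0 : ℝ)..1, inner ℝ (d (lineMap x y t)) (y - x)

theorem segmentIntegral_symm (d : E → E) (x y : E) :
    segmentIntegral d y x = -segmentIntegral d x y := by
  unfold segmentIntegral
  have h := intervalIntegral.integral_comp_sub_left
    (fun t : ℝ => inner ℝ (d (lineMap x y t)) (y - x)) (a := 0) (b := 1) 1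
  simp only [sub_self, sub_zero] at h
  rw [← h, ← intervalIntegral.integral_neg]
  refine intervalIntegral.integral_congr fun t _ => ?_
  simp only [lineMap_apply_one_sub]
  rw [← inner_neg_right, neg_sub]

variable {d : E → E} {K : Set E}

theorem MintyMonotoneOn.monotoneOn_segment (hd : MintyMonotoneOn d K) (hK : Convex ℝ K) {x y : E}
    (hx : x ∈ K) (hy : y ∈ K) :
    MonotoneOn (fun t : ℝ => inner ℝ (d (lineMap x y t)) (y - x)) (Icc 0 1) := by
  intro s hs t ht hst
  rcases hst.eq_or_lt with rfl | hlt
  · exact le_rfl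
  have h := hd _ (hK.lineMap_mem hx hy ht) _ (hK.lineMap_mem hx hy hs)
  have e : (lineMap x y t : E) - lineMap x y s = (t - s) • (y - x) := by
    simp only [lineMap_apply, vsub_eq_sub, vadd_eq_add]
    module
  rw [e, real_inner_smul_left] at h
  have h2 := nonneg_of_mul_nonneg_right h (sub_pos.2 hlt)
  rw [inner_sub_right, real_inner_comm, real_inner_comm (d (lineMap x y s))] at h2
  simp only
  linarith

/-- Monotonicity of the integrand replaces any measurability assumption on `d`. -/
theorem MintyMonotoneOn.intervalIntegrable_segment (hd : MintyMonotoneOn d K) (hK : Convex ℝ K)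
    {x y : E} (hx : x ∈ K) (hy : y ∈ K) {a b : ℝ} (ha : a ∈ Icc (0 : ℝ) 1)
    (hb : b ∈ Icc (0 : ℝ) 1) :
    IntervalIntegrable (fun t : ℝ => inner ℝ (d (lineMap x y t)) (y - x)) volume a b :=
  ((hd.monotoneOn_segment hK hx hy).mono (uIcc_subset_Icc ha hb)).intervalIntegrable

theorem MintyMonotoneOn.le_segmentIntegral (hd : MintyMonotoneOn d K) (hK : Convex ℝ K) {x y : E}
    (hx : x ∈ K) (hy : y ∈ K) : inner ℝ (d x) (y - x) ≤ segmentIntegral d x y := by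
  have h := intervalIntegral.integral_mono_on (a := (0 : ℝ)) (b := 1) (μ := volume)
    (f := fun _ => inner ℝ (d x) (y - x)) (g := fun t => inner ℝ (d (lineMap x y t)) (y - x))
    zero_le_one (by simp)
    (hd.intervalIntegrable_segment hK hx hy (by simp) (by simp)) (fun t ht => by
      have := hd.monotoneOn_segment hK hx hy (left_mem_Icc.2 zero_le_one) ht ht.1
      simpa using this)
  simpa [segmentIntegral] using h

theorem MintyMonotoneOn.segmentIntegral_le (hd : MintyMonotoneOn d K) (hK : Convex ℝ K) {x y : E}
    (hx : x ∈ K) (hy : y ∈ K) : segmentIntegral d x y ≤ inner ℝ (d y) (y - x) := by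
  have h := hd.le_segmentIntegral hK hy hx
  rw [segmentIntegral_symm, ← neg_sub y x, inner_neg_right] at h
  linarith

theorem MintyMonotoneOn.segmentIntegral_add_midpoint (hd : MintyMonotoneOn d K) (hK : Convex ℝ K)
    {x y : E} (hx : x ∈ K) (hy : y ∈ K) :
    segmentIntegral d x (midpoint ℝ x y) + segmentIntegral d (midpoint ℝ x y) y =
      segmentIntegral d x y := by
  set f : ℝ → ℝ := fun t => inner ℝ (d (lineMap x y t)) (y - x) with hf
  have h1 : segmentIntegral d x (midpoint ℝ x y) = ∫ t in (0 : ℝ)..(1 / 2), f t := by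
    have := intervalIntegral.integral_comp_mul_left f (a := 0) (b := 1)
      (c := (1 / 2 : ℝ)) (by norm_num)
    rw [mul_zero, mul_one] at this
    have h2 : ∫ t in (0 : ℝ)..(1 / 2), f t = (1 / 2 : ℝ) * ∫ t in (0 : ℝ)..1, f (1 / 2 * t) := by
      rw [this]; simp
    rw [h2, segmentIntegral, ← intervalIntegral.integral_const_mul]
    refine intervalIntegral.integral_congr fun t _ => ?_
    have e1 : midpoint ℝ x y - x = (1 / 2 : ℝ) • (y - x) := by
      rw [midpoint_eq_smul_add, invOf_eq_inv]; module
    have e2 : (lineMap x (midpoint ℝ x y) t : E) = lineMap x y (1 / 2 * t) := by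
      rw [midpoint_eq_smul_add, invOf_eq_inv]
      simp only [lineMap_apply, vsub_eq_sub, vadd_eq_add]
      module
    simp only [hf, e1, e2, real_inner_smul_right]
  have h2 : segmentIntegral d (midpoint ℝ x y) y = ∫ t in (1 / 2 : ℝ)..1, f t := by
    have := intervalIntegral.integral_comp_add_mul f (a := 0) (b := 1)
      (c := (1 / 2 : ℝ)) (by norm_num) (1 / 2)
    rw [mul_zero, mul_one, add_zero, add_halves] at this
    have h2 : ∫ t in (1 / 2 : ℝ)..1, f t =
        (1 / 2 : ℝ) * ∫ t in (0 : ℝ)..1, f (1 / 2 + 1 / 2 * t) := by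
      rw [this]; simp
    rw [h2, segmentIntegral, ← intervalIntegral.integral_const_mul]
    refine intervalIntegral.integral_congr fun t _ => ?_
    have e1 : y - midpoint ℝ x y = (1 / 2 : ℝ) • (y - x) := by
      rw [midpoint_eq_smul_add, invOf_eq_inv]; module
    have e2 : (lineMap (midpoint ℝ x y) y t : E) = lineMap x y (1 / 2 + 1 / 2 * t) := by
      rw [midpoint_eq_smul_add, invOf_eq_inv]
      simp only [lineMap_apply, vsub_eq_sub, vadd_eq_add]
      module
    simp only [hf, e1, e2, real_inner_smul_right]
  rw [h1, h2, segmentIntegral]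
  exact intervalIntegral.integral_add_adjacent_intervals
    (hd.intervalIntegrable_segment hK hx hy (by simp) (by norm_num))
    (hd.intervalIntegrable_segment hK hx hy (by norm_num) (by simp))

/-- Where `d` is a selection of subgradients of `ψ`, its segment integrals are the increments
of `ψ`. -/
theorem MintyMonotoneOn.segmentIntegral_eq_sub (hd : MintyMonotoneOn d K) (hK : Convex ℝ K)
    {ψ : E → ℝ} (hψ : ∀ x ∈ K, ∀ y ∈ K, ψ x + inner ℝ (d x) (y - x) ≤ ψ y) {x y : E}
    (hx : x ∈ K) (hy : y ∈ K) : segmentIntegral d x y = ψ y - ψ x := by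
  -- Both quantities lie between `⟪d x, y - x⟫` and `⟪d y, y - x⟫`. Under bisection the two
  -- half-segment bounds add up, the midpoint value of `d` cancels, and a factor `1 / 2` is gained.
  have key : ∀ k : ℕ, ∀ x ∈ K, ∀ y ∈ K,
      |segmentIntegral d x y - (ψ y - ψ x)| ≤ (1 / 2) ^ k * inner ℝ (d y - d x) (y - x) := by
    intro k
    induction k with
    | zero =>
      intro x hx y hy
      have h1 := hd.le_segmentIntegral hK hx hy
      have h2 := hd.segmentIntegral_le hK hx hy
      have h3 := hψ x hx y hy
      have h4 := hψ y hy x hx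
      rw [← neg_sub y x, inner_neg_right] at h4
      rw [pow_zero, one_mul, inner_sub_left, abs_le]
      constructor <;> linarith
    | succ k ih =>
      intro x hx y hy
      have hm : midpoint ℝ x y ∈ K := hK.midpoint_mem hx hy
      have h1 := ih x hx _ hm
      have h2 := ih _ hm y hy
      have e1 : midpoint ℝ x y - x = (1 / 2 : ℝ) • (y - x) := by
        rw [midpoint_eq_smul_add, invOf_eq_inv]; module
      have e2 : y - midpoint ℝ x y = (1 / 2 : ℝ) • (y - x) := by
        rw [midpoint_eq_smul_add, invOf_eq_inv]; module
      rw [e1, real_inner_smul_right, inner_sub_left] at h1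
      rw [e2, real_inner_smul_right, inner_sub_left] at h2
      rw [← hd.segmentIntegral_add_midpoint hK hx hy, inner_sub_left, pow_succ]
      rw [abs_le] at h1 h2 ⊢
      constructor <;> linarith [h1.1, h1.2, h2.1, h2.2]
  have hlim : Tendsto (fun k : ℕ => (1 / 2 : ℝ) ^ k * inner ℝ (d y - d x) (y - x)) atTop (𝓝 0) := by
    simpa using (tendsto_pow_atTop_nhds_zero_of_lt_one (by norm_num : (0 : ℝ) ≤ 1 / 2)
      (by norm_num)).mul_const (inner ℝ (d y - d x) (y - x))
  have h0 : |segmentIntegral d x y - (ψ y - ψ x)| ≤ 0 :=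
    ge_of_tendsto' hlim fun k => key k x hx y hy
  exact sub_eq_zero.1 (abs_nonpos_iff.1 h0)

/-- The circulation of a monotone vector field of finite range along a triangle vanishes. -/
theorem MintyMonotoneOn.segmentIntegral_triangle (hd : MintyMonotoneOn d K) (hK : Convex ℝ K)
    (hfin : (d '' K).Finite) {a b c : E} (ha : a ∈ K) (hb : b ∈ K) (hc : c ∈ K) :
    segmentIntegral d a b + segmentIntegral d b c + segmentIntegral d c a = 0 := by
  choose r hr hloc using hd.exists_ball_inner_nonneg hfin
  set L : Set E := convexHull ℝ {a, b, c} with hL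
  have hLK : L ⊆ K := convexHull_min (by rintro _ (rfl | rfl | rfl) <;> assumption) hK
  have hLc : Convex ℝ L := convex_convexHull ℝ _
  have hdL : MintyMonotoneOn d L := fun x hx y hy => hd x (hLK hx) y (hLK hy)
  have hcomp : IsCompact L := (Set.toFinite _).isCompact_convexHull ℝ
  obtain ⟨δ, hδ, hδL⟩ := lebesgue_number_lemma_of_metric (s := L)
    (c := fun x : E => Metric.ball x (r x)) hcomp (fun x => Metric.isOpen_ball)
    (fun x _ => mem_iUnion.2 ⟨x, Metric.mem_ball_self (hr x)⟩)
  -- Induction on the scale: triangles smaller than the Lebesgue number `δ` have a local potential,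
  -- and midpoint subdivision halves the sides.
  have key : ∀ k : ℕ, ∀ a ∈ L, ∀ b ∈ L, ∀ c ∈ L, dist a b < 2 ^ k * δ → dist b c < 2 ^ k * δ →
      dist c a < 2 ^ k * δ →
      segmentIntegral d a b + segmentIntegral d b c + segmentIntegral d c a = 0 := by
    intro k
    induction k with
    | zero =>
      intro a ha b hb c hc hab hbc hca
      rw [pow_zero, one_mul] at hab hbc hca
      obtain ⟨x, hx⟩ := hδL a ha
      have hcv : Convex ℝ (L ∩ Metric.ball a δ) := hLc.inter (convex_ball a δ)
      have hdm : MintyMonotoneOn d (L ∩ Metric.ball a δ) :=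
        fun x hx y hy => hdL x hx.1 y hy.1
      -- The local potential is `y ↦ ⟪d y, y - x⟫`, with `x` the centre of the covering ball; `x`
      -- itself need not be in `K`.
      have hψ : ∀ y ∈ L ∩ Metric.ball a δ, ∀ z ∈ L ∩ Metric.ball a δ,
          inner ℝ (d y) (y - x) + inner ℝ (d y) (z - y) ≤ inner ℝ (d z) (z - x) := by
        intro y hy z hz
        have := hloc x z (hLK hz.1) y (hLK hy.1) (hx hy.2)
        rw [inner_sub_left] at this
        rw [← inner_add_right, sub_add_sub_cancel']
        linarith
      have ha' : a ∈ L ∩ Metric.ball a δ := ⟨ha, Metric.mem_ball_self hδ⟩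
      have hb' : b ∈ L ∩ Metric.ball a δ := ⟨hb, by rwa [Metric.mem_ball, dist_comm]⟩
      have hc' : c ∈ L ∩ Metric.ball a δ := ⟨hc, hca⟩
      rw [hdm.segmentIntegral_eq_sub hcv hψ ha' hb', hdm.segmentIntegral_eq_sub hcv hψ hb' hc',
        hdm.segmentIntegral_eq_sub hcv hψ hc' ha']
      ring
    | succ k ih =>
      intro a ha b hb c hc hab hbc hca
      have hp := hLc.midpoint_mem ha hb
      have hq := hLc.midpoint_mem hb hc
      have hs := hLc.midpoint_mem hc ha
      have half : ∀ u v : E, dist u v < 2 ^ (k + 1) * δ → ‖(1 / 2 : ℝ) • (u - v)‖ < 2 ^ k * δ := by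
        intro u v h
        rw [norm_smul, ← dist_eq_norm]
        rw [pow_succ] at h
        norm_num
        linarith
      have cmp : ∀ p q u v : E, dist u v < 2 ^ (k + 1) * δ →
          (p - q = (1 / 2 : ℝ) • (u - v) ∨ q - p = (1 / 2 : ℝ) • (u - v)) →
          dist p q < 2 ^ k * δ := by
        rintro p q u v h (e | e)
        · rw [dist_eq_norm, e]; exact half u v h
        · rw [dist_comm, dist_eq_norm, e]; exact half u v h
      -- Three corner triangles and the medial one; the inner edges cancel in the sum.
      have t1 := ih a ha _ hp _ hs
        (cmp _ _ a b hab (.inl (by rw [midpoint_eq_smul_add, invOf_eq_inv]; module)))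
        (cmp _ _ b c hbc (.inl (by simp only [midpoint_eq_smul_add, invOf_eq_inv]; module)))
        (cmp _ _ c a hca (.inl (by simp only [midpoint_eq_smul_add, invOf_eq_inv]; module)))
      have t2 := ih _ hp b hb _ hq
        (cmp _ _ a b hab (.inl (by rw [midpoint_eq_smul_add, invOf_eq_inv]; module)))
        (cmp _ _ b c hbc (.inl (by simp only [midpoint_eq_smul_add, invOf_eq_inv]; module)))
        (cmp _ _ c a hca (.inl (by simp only [midpoint_eq_smul_add, invOf_eq_inv]; module)))
      have t3 := ih _ hq c hc _ hs
        (cmp _ _ b c hbc (.inl (by rw [midpoint_eq_smul_add, invOf_eq_inv]; module)))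
        (cmp _ _ c a hca (.inl (by simp only [midpoint_eq_smul_add, invOf_eq_inv]; module)))
        (cmp _ _ a b hab (.inl (by simp only [midpoint_eq_smul_add, invOf_eq_inv]; module)))
      have t4 := ih _ hp _ hq _ hs
        (cmp _ _ c a hca (.inr (by simp only [midpoint_eq_smul_add, invOf_eq_inv]; module)))
        (cmp _ _ a b hab (.inr (by simp only [midpoint_eq_smul_add, invOf_eq_inv]; module)))
        (cmp _ _ b c hbc (.inr (by simp only [midpoint_eq_smul_add, invOf_eq_inv]; module)))
      rw [← hdL.segmentIntegral_add_midpoint hLc ha hb,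
        ← hdL.segmentIntegral_add_midpoint hLc hb hc, ← hdL.segmentIntegral_add_midpoint hLc hc ha]
      have s1 := segmentIntegral_symm d (midpoint ℝ a b) (midpoint ℝ c a)
      have s2 := segmentIntegral_symm d (midpoint ℝ a b) (midpoint ℝ b c)
      have s3 := segmentIntegral_symm d (midpoint ℝ b c) (midpoint ℝ c a)
      linarith
  obtain ⟨k, hk⟩ := pow_unbounded_of_one_lt ((dist a b + dist b c + dist c a) / δ) one_lt_two
  rw [div_lt_iff₀ hδ] at hk
  have h1 := dist_nonneg (x := a) (y := b)
  have h2 := dist_nonneg (x := b) (y := c)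
  have h3 := dist_nonneg (x := c) (y := a)
  exact key k a (subset_convexHull ℝ _ (by simp)) b (subset_convexHull ℝ _ (by simp)) c
    (subset_convexHull ℝ _ (by simp)) (by linarith) (by linarith) (by linarith)

/-- A monotone map of finite range on a convex set admits a slope potential. -/
theorem MintyMonotoneOn.exists_isSlopePotentialOn (hd : MintyMonotoneOn d K) (hK : Convex ℝ K)
    (hfin : (d '' K).Finite) : ∃ c, IsSlopePotentialOn d c K := by
  rcases K.eq_empty_or_nonempty with rfl | ⟨o, ho⟩
  · exact ⟨0, fun x hx => absurd hx (notMem_empty x)⟩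
  -- The triangle identity turns the increment of the potential into `segmentIntegral d x y`, which
  -- is at least `⟪d x, y - x⟫`.
  obtain ⟨c, hc, -⟩ := exists_isSlopePotentialOn_of_subgradient (T := d) (S := K)
    (φ := segmentIntegral d o) (fun x hx y hy => by
      have h1 := hd.segmentIntegral_triangle hK hfin ho hx hy
      have h2 := segmentIntegral_symm d o y
      have h3 := hd.le_segmentIntegral hK hx hy
      linarith)
  exact ⟨c, hc⟩

end Potential

/-! ### Slope potentials and cyclic monotonicity. -/

/-- A map with a slope potential is cyclically monotone. -/
theorem IsSlopePotentialOn.cyclicallyMonotoneOn {n : ℕ} {T : Rn n → Rn n} {c : Rn n → ℝ}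
    {S : Set (Rn n)} (h : IsSlopePotentialOn T c S) : CyclicallyMonotoneOn T S := by
  intro m u hu
  have h1 : ∑ i, (inner ℝ (T (u (i + 1))) (u i) + c (T (u (i + 1)))) ≤
      ∑ i, (inner ℝ (T (u i)) (u i) + c (T (u i))) :=
    Finset.sum_le_sum fun i _ => h _ (hu i) _ (hu (i + 1))
  have h2 : ∑ i, c (T (u (i + 1))) = ∑ i, c (T (u i)) :=
    Equiv.sum_comp (Equiv.addRight (1 : Fin (m + 1))) fun i => c (T (u i))
  have h3 : ∑ i, ‖T (u (i + 1))‖ ^ 2 = ∑ i, ‖T (u i)‖ ^ 2 :=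
    Equiv.sum_comp (Equiv.addRight (1 : Fin (m + 1))) fun i => ‖T (u i)‖ ^ 2
  simp only [norm_sub_sq_real, Finset.sum_add_distrib, Finset.sum_sub_distrib,
    ← Finset.mul_sum] at h1 ⊢
  simp only [real_inner_comm] at h1 ⊢
  linarith

theorem CyclicallyMonotoneOn.mintyMonotoneOn {n : ℕ} {T : Rn n → Rn n} {S : Set (Rn n)}
    (h : CyclicallyMonotoneOn T S) : MintyMonotoneOn T S := by
  intro x hx y hy
  have h2 : ∑ i : Fin 2, ‖![x, y] i - T (![x, y] i)‖ ^ 2 ≤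
      ∑ i : Fin 2, ‖![x, y] i - T (![x, y] (i + 1))‖ ^ 2 :=
    h 1 ![x, y] (by intro i; fin_cases i <;> simpa)
  simp only [Fin.sum_univ_two, Fin.isValue, Matrix.cons_val_zero, Matrix.cons_val_one, zero_add,
    show (1 : Fin 2) + 1 = 0 from rfl, norm_sub_sq_real] at h2
  rw [inner_sub_left, inner_sub_right, inner_sub_right]
  linarith

/-! ### Brenier maps to finitely supported measures: gradients and uniqueness. -/

section AlmostEverywhere

variable {n : ℕ}

theorem volume_hyperplane_eq_zero {v : Rn n} (hv : v ≠ 0) (γ : ℝ) :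
    volume {x : Rn n | inner ℝ v x = γ} = 0 := by
  let A : AffineSubspace ℝ (Rn n) :=
    (AffineSubspace.mk' γ (⊥ : Submodule ℝ ℝ)).comap (innerSL ℝ v).toLinearMap.toAffineMap
  have hA : {x : Rn n | inner ℝ v x = γ} = A := by
    ext x
    simp [A, AffineSubspace.mem_mk', sub_eq_zero]
  rw [hA]
  refine Measure.addHaar_affineSubspace volume A fun htop => hv ?_
  have hmem : ∀ x, inner ℝ v x = γ := by
    intro x
    have : x ∈ (A : Set (Rn n)) := by rw [htop]; trivial
    rwa [← hA] at this
  rw [← inner_self_eq_zero (𝕜 := ℝ), hmem v, ← hmem 0, inner_zero_right]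

/-- Each tie between two slopes is confined to a hyperplane, so the maximal slope is almost
everywhere unique. -/
theorem ae_forall_ne_inner_ne {F : Set (Rn n)} (hF : F.Finite) (c : Rn n → ℝ) :
    ∀ᵐ x : Rn n, ∀ a ∈ F, ∀ b ∈ F, a ≠ b → inner ℝ a x + c a ≠ inner ℝ b x + c b := by
  refine (ae_ball_iff hF.countable).2 fun a _ => (ae_ball_iff hF.countable).2 fun b _ => ?_
  by_cases hab : a = b
  · exact Eventually.of_forall fun x h => absurd hab h
  · have h0 := volume_hyperplane_eq_zero (sub_ne_zero.2 hab) (c b - c a)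
    have h1 : ∀ᵐ x : Rn n, inner ℝ (a - b) x ≠ c b - c a := by
      rw [ae_iff]; simpa using h0
    filter_upwards [h1] with x hx _ h
    refine hx ?_
    rw [inner_sub_left]
    linarith

/-- A selection of maximal slopes among finitely many affine functions is almost everywhere the
gradient of their maximum. -/
theorem exists_convexOn_univ_gradient_eq {T : Rn n → Rn n} {c : Rn n → ℝ} {S : Set (Rn n)}
    (hT : IsSlopePotentialOn T c S) (hfin : (T '' S).Finite) :
    ∃ φ : Rn n → ℝ, ConvexOn ℝ univ φ ∧
      ∀ᵐ x : Rn n, x ∈ S → DifferentiableAt ℝ φ x ∧ ∇ φ x = T x := by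
  rcases S.eq_empty_or_nonempty with rfl | hne
  · exact ⟨0, convexOn_const 0 convex_univ, Eventually.of_forall fun x hx => absurd hx (by simp)⟩
  have hex : ∀ x : Rn n, ∃ a ∈ T '' S, ∀ b ∈ T '' S, inner ℝ b x + c b ≤ inner ℝ a x + c a :=
    fun x => Set.exists_max_image (T '' S) (fun a => inner ℝ a x + c a) hfin (hne.image T)
  choose m hmS hmax using hex
  refine ⟨fun x => inner ℝ (m x) x + c (m x), ⟨convex_univ, ?_⟩, ?_⟩
  · intro x _ y _ s t hs ht hst
    have h1 := mul_le_mul_of_nonneg_left (hmax x _ (hmS (s • x + t • y))) hs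
    have h2 := mul_le_mul_of_nonneg_left (hmax y _ (hmS (s • x + t • y))) ht
    have h3 : c (m (s • x + t • y)) = s * c (m (s • x + t • y)) + t * c (m (s • x + t • y)) := by
      rw [← add_mul, hst, one_mul]
    simp only [smul_eq_mul]
    rw [inner_add_right, real_inner_smul_right, real_inner_smul_right, h3]
    linarith
  · filter_upwards [ae_forall_ne_inner_ne hfin c] with x hx hxS
    have hTx : T x ∈ T '' S := mem_image_of_mem T hxS
    have hlt : ∀ᶠ y in 𝓝 x, ∀ b ∈ T '' S, b ≠ T x →
        inner ℝ b y + c b < inner ℝ (T x) y + c (T x) := by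
      rw [eventually_all_finite hfin]
      rintro b hb
      by_cases hbx : b = T x
      · exact Eventually.of_forall fun y h => absurd hbx h
      · have hle : inner ℝ b x + c b ≤ inner ℝ (T x) x + c (T x) := by
          obtain ⟨z, hz, rfl⟩ := hb
          exact hT x hxS z hz
        have hopen : IsOpen {y : Rn n | inner ℝ b y + c b < inner ℝ (T x) y + c (T x)} :=
          isOpen_lt (by fun_prop) (by fun_prop)
        filter_upwards [hopen.mem_nhds (lt_of_le_of_ne hle (hx b hb _ hTx hbx))] with y hy _
          using hy
    have heq : (fun y => inner ℝ (m y) y + c (m y)) =ᶠ[𝓝 x]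
        fun y => inner ℝ (T x) y + c (T x) := by
      filter_upwards [hlt] with y hy
      have : m y = T x := by
        by_contra hne
        exact absurd (hmax y _ hTx) (not_le.2 (hy _ (hmS y) hne))
      rw [this]
    have hg : HasGradientAt (fun y => inner ℝ (T x) y + c (T x)) (T x) x := by
      rw [hasGradientAt_iff_hasFDerivAt]
      exact ((InnerProductSpace.toDual ℝ (Rn n) (T x)).hasFDerivAt).add_const _
    have hg' := hg.congr_of_eventuallyEq heq
    exact ⟨hg'.differentiableAt, hg'.gradient⟩

theorem measurable_gradient (φ : Rn n → ℝ) : Measurable (∇ φ) :=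
  (InnerProductSpace.toDual ℝ (Rn n)).symm.continuous.measurable.comp (measurable_fderiv ℝ φ)

theorem IsSlopePotentialOn.aemeasurable {P : Measure (Rn n)} (hP : P ≪ volume) {T : Rn n → Rn n}
    {c : Rn n → ℝ} {S : Set (Rn n)} (hT : IsSlopePotentialOn T c S) (hfin : (T '' S).Finite)
    (hS : ∀ᵐ x ∂P, x ∈ S) : AEMeasurable T P := by
  obtain ⟨φ, -, h⟩ := exists_convexOn_univ_gradient_eq hT hfin
  refine ⟨∇ φ, measurable_gradient φ, ?_⟩
  filter_upwards [hP.ae_le h, hS] with x hx hxS using (hx hxS).2.symm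

theorem IsSlopePotentialOn.isGradientTransport {P Q : Measure (Rn n)} (hP : P ≪ volume)
    {T : Rn n → Rn n} {c : Rn n → ℝ} {S : Set (Rn n)} (hT : IsSlopePotentialOn T c S)
    (hfin : (T '' S).Finite) (hS : ∀ᵐ x ∂P, x ∈ S) (hPQ : P.map T = Q) :
    IsGradientTransport P Q T := by
  obtain ⟨φ, hφ, h⟩ := exists_convexOn_univ_gradient_eq hT hfin
  have hae : ∀ᵐ x ∂P, DifferentiableAt ℝ φ x ∧ ∇ φ x = T x := by
    filter_upwards [hP.ae_le h, hS] with x hx hxS using hx hxS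
  have hTφ : T =ᵐ[P] ∇ φ := by filter_upwards [hae] with x hx using hx.2.symm
  refine ⟨univ, φ, ⟨hφ, ?_, (measurable_gradient φ).aemeasurable, ?_⟩, hTφ⟩
  · filter_upwards [hae] with x hx
    exact ⟨by simp, hx.1⟩
  · rw [← hPQ, Measure.map_congr hTφ]

/-- The gradient of a convex function is a subgradient. -/
theorem ConvexOn.add_inner_gradient_le {C : Set (Rn n)} {φ : Rn n → ℝ} (hφ : ConvexOn ℝ C φ)
    {x y : Rn n} (hx : x ∈ C) (hy : y ∈ C) (hd : DifferentiableAt ℝ φ x) :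
    φ x + inner ℝ (∇ φ x) (y - x) ≤ φ y := by
  have hconv : ConvexOn ℝ (Icc (0 : ℝ) 1) (φ ∘ (lineMap x y : ℝ →ᵃ[ℝ] Rn n)) :=
    (hφ.comp_affineMap (lineMap x y)).subset
      (fun t ht => hφ.1.lineMap_mem hx hy ht) (convex_Icc 0 1)
  have hline : HasDerivAt (lineMap x y : ℝ → Rn n) (y - x) 0 := by
    have h := (hasDerivAt_id (0 : ℝ)).smul_const (y - x)
    simp only [one_smul] at h
    refine (h.add_const x).congr_of_eventuallyEq (Eventually.of_forall fun t => ?_)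
    simp [lineMap_apply]
  have hφ' : HasFDerivAt φ (InnerProductSpace.toDual ℝ (Rn n) (∇ φ x)) (lineMap x y (0 : ℝ)) := by
    rw [lineMap_apply_zero]
    exact hd.hasGradientAt.hasFDerivAt
  have hder := hφ'.comp_hasDerivAt 0 hline
  have h := hconv.le_slope_of_hasDerivAt (x := 0) (y := 1) (by simp) (by simp) one_pos hder
  simp only [InnerProductSpace.toDual_apply_apply, slope_def_field, Function.comp_apply,
    lineMap_apply_one, lineMap_apply_zero, sub_zero, div_one] at h
  linarith

theorem IsBrenierPotential.exists_isSlopePotentialOn {P Q : Measure (Rn n)} {C : Set (Rn n)}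
    {φ : Rn n → ℝ} (h : IsBrenierPotential P Q C φ) :
    ∃ c S, IsSlopePotentialOn (∇ φ) c S ∧ (∀ᵐ x ∂P, x ∈ S) ∧
      S = {x | x ∈ interior C ∧ DifferentiableAt ℝ φ x} ∧
      ∀ x ∈ S, c (∇ φ x) = φ x - inner ℝ (∇ φ x) x := by
  obtain ⟨c, hc, hcφ⟩ := exists_isSlopePotentialOn_of_subgradient (T := ∇ φ) (φ := φ)
    (S := {x | x ∈ interior C ∧ DifferentiableAt ℝ φ x})
    (fun x hx y hy => h.1.add_inner_gradient_le (interior_subset hx.1) (interior_subset hy.1) hx.2)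
  exact ⟨c, _, hc, h.2.1, rfl, hcφ⟩

/-- Two maps with slope potentials that push an absolutely continuous probability measure to the
same finitely supported measure agree almost everywhere. -/
theorem IsSlopePotentialOn.ae_eq {P Q : Measure (Rn n)} [IsProbabilityMeasure P]
    (hP : P ≪ volume) {F : Set (Rn n)} (hF : F.Finite) (hQF : Q Fᶜ = 0)
    {T T' : Rn n → Rn n} {c c' : Rn n → ℝ} {S S' : Set (Rn n)}
    (hT : IsSlopePotentialOn T c S) (hT' : IsSlopePotentialOn T' c' S')
    (hS : ∀ᵐ x ∂P, x ∈ S) (hS' : ∀ᵐ x ∂P, x ∈ S')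
    (hTm : AEMeasurable T P) (hTm' : AEMeasurable T' P)
    (hTQ : P.map T = Q) (hTQ' : P.map T' = Q) : T =ᵐ[P] T' := by
  classical
  -- Without the null atoms, every remaining value is attained by both maps, on `S` and on `S'`;
  -- only then can the two maximality properties be compared.
  set A : Set (Rn n) := {a ∈ F | Q {a} ≠ 0} with hA
  have hAfin : A.Finite := hF.subset (sep_subset _ _)
  have hQA : Q Aᶜ = 0 := by
    have hsub : Aᶜ ⊆ Fᶜ ∪ ⋃ a ∈ F \ A, {a} := by
      intro a ha
      by_cases haF : a ∈ F
      · exact Or.inr (mem_biUnion (x := a) ⟨haF, ha⟩ rfl)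
      · exact Or.inl haF
    refine measure_mono_null hsub (measure_union_null hQF ?_)
    refine (measure_biUnion_null_iff (hF.subset sdiff_subset).countable).2 fun a ha => ?_
    by_contra h
    exact ha.2 ⟨ha.1, h⟩
  have hval : ∀ {U : Rn n → Rn n}, AEMeasurable U P → P.map U = Q → ∀ᵐ x ∂P, U x ∈ A := by
    intro U hU hUQ
    refine ae_of_ae_map hU (p := fun a => a ∈ A) ?_
    rw [hUQ, ae_iff]
    exact hQA
  have hatt : ∀ {U : Rn n → Rn n} {R : Set (Rn n)}, AEMeasurable U P → P.map U = Q →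
      (∀ᵐ x ∂P, x ∈ R) → ∀ a ∈ A, ∃ x ∈ R, U x = a := by
    intro U R hU hUQ hR a ha
    by_contra! hcon
    refine ha.2 ?_
    rw [← hUQ, Measure.map_apply_of_aemeasurable hU (measurableSet_singleton a)]
    have h : ∀ᵐ x ∂P, x ∉ U ⁻¹' {a} := by
      filter_upwards [hR] with x hx using hcon x hx
    exact measure_eq_zero_iff_ae_notMem.2 h
  have hslack : ∀ᵐ x ∂P, inner ℝ (T' x) x + c (T' x) ≤ inner ℝ (T x) x + c (T x) := by
    filter_upwards [hS, hval hTm' hTQ'] with x hx hxA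
    obtain ⟨y, hy, hyT⟩ := hatt hTm hTQ hS _ hxA
    rw [← hyT]
    exact hT x hx y hy
  have hslack' : ∀ᵐ x ∂P, inner ℝ (T x) x + c' (T x) ≤ inner ℝ (T' x) x + c' (T' x) := by
    filter_upwards [hS', hval hTm hTQ] with x hx hxA
    obtain ⟨y, hy, hyT⟩ := hatt hTm' hTQ' hS' _ hxA
    rw [← hyT]
    exact hT' x hx y hy
  -- Adding the two slackness inequalities gives `k (T' x) ≤ k (T x)`, while the integrals coincide
  -- because the laws do. The indicator makes `k` bounded, so no moments are needed.
  set k : Rn n → ℝ := A.indicator fun a => c a - c' a with hk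
  have hkm : Measurable k := by
    have : k = fun a =>
        ∑ b ∈ hAfin.toFinset, ({b} : Set (Rn n)).indicator (fun b => c b - c' b) a := by
      funext a
      simp only [hk, indicator_apply, mem_singleton_iff, Finset.sum_ite_eq,
        Finite.mem_toFinset]
    rw [this]
    refine Finset.measurable_sum _ fun b _ => ?_
    have : ({b} : Set (Rn n)).indicator (fun b => c b - c' b) =
        ({b} : Set (Rn n)).indicator fun _ => c b - c' b := by
      refine indicator_congr fun a ha => ?_
      rw [mem_singleton_iff.1 ha]
    rw [this]
    exact measurable_const.indicator (measurableSet_singleton b)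
  have hkb : ∃ M, ∀ a, ‖k a‖ ≤ M := by
    obtain ⟨M, hM⟩ := (hAfin.image fun a => ‖c a - c' a‖).bddAbove
    refine ⟨max M 0, fun a => ?_⟩
    by_cases ha : a ∈ A
    · rw [hk, indicator_of_mem ha]
      exact le_max_of_le_left (hM (mem_image_of_mem _ ha))
    · rw [hk, indicator_of_notMem ha, norm_zero]
      exact le_max_right _ _
  obtain ⟨M, hM⟩ := hkb
  have hint : ∀ {U : Rn n → Rn n}, AEMeasurable U P → Integrable (fun x => k (U x)) P := by
    intro U hU
    exact Integrable.of_bound (hkm.comp_aemeasurable hU).aestronglyMeasurable M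
      (Eventually.of_forall fun x => hM _)
  have heq : ∫ x, (k (T x) - k (T' x)) ∂P = 0 := by
    rw [integral_sub (hint hTm) (hint hTm'), ← integral_map hTm hkm.aestronglyMeasurable,
      ← integral_map hTm' hkm.aestronglyMeasurable, hTQ, hTQ', sub_self]
  have hnn : 0 ≤ᵐ[P] fun x => k (T x) - k (T' x) := by
    filter_upwards [hslack, hslack', hval hTm hTQ, hval hTm' hTQ'] with x h1 h2 h3 h4
    simp only [hk, indicator_of_mem h3, indicator_of_mem h4, Pi.zero_apply]
    linarith
  have hzero := (integral_eq_zero_iff_of_nonneg_ae hnn ((hint hTm).sub (hint hTm'))).1 heq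
  filter_upwards [hslack, hslack', hval hTm hTQ, hval hTm' hTQ', hzero,
    hP.ae_le (ae_forall_ne_inner_ne hAfin c)] with x h1 h2 h3 h4 h5 h6
  by_contra hne
  -- Equality of the `k` values makes both slackness inequalities equalities, that is, a tie.
  refine h6 _ h3 _ h4 hne ?_
  simp only [hk, indicator_of_mem h3, indicator_of_mem h4, Pi.zero_apply] at h5
  linarith

/-- A transport map with a slope potential to a finitely supported measure is the Brenier map. -/
theorem IsSlopePotentialOn.isBrenierMap {P Q : Measure (Rn n)} [IsProbabilityMeasure P]
    (hP : P ≪ volume) {F : Set (Rn n)} (hF : F.Finite) (hQF : Q Fᶜ = 0)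
    {T : Rn n → Rn n} {c : Rn n → ℝ} {S : Set (Rn n)} (hT : IsSlopePotentialOn T c S)
    (hfin : (T '' S).Finite) (hS : ∀ᵐ x ∂P, x ∈ S) (hPQ : P.map T = Q) : IsBrenierMap P Q T := by
  refine ⟨hT.isGradientTransport hP hfin hS hPQ, ?_⟩
  rintro U ⟨C, φ, hφ, hU⟩
  obtain ⟨c', S', hc', hS', -⟩ := hφ.exists_isSlopePotentialOn
  exact hU.trans (hc'.ae_eq hP hF hQF hT hS' hS hφ.2.2.1 (hT.aemeasurable hP hfin hS) hφ.2.2.2 hPQ)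

/-- Two-point cycles already give a slope potential on the convex set `K`, to which uniqueness
applies. -/
theorem IsMonotoneTransportOn.ae_eq {P Q : Measure (Rn n)} [IsProbabilityMeasure P]
    (hP : P ≪ volume) {K F : Set (Rn n)} (hK : Convex ℝ K) (hPK : ∀ᵐ x ∂P, x ∈ K)
    (hF : F.Finite) (hQF : Q Fᶜ = 0) {T T' : Rn n → Rn n}
    (hT : IsMonotoneTransportOn P Q K F T) {c : Rn n → ℝ} {S : Set (Rn n)}
    (hT' : IsSlopePotentialOn T' c S) (hfin : (T' '' S).Finite) (hS : ∀ᵐ x ∂P, x ∈ S)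
    (hPQ : P.map T' = Q) : T =ᵐ[P] T' := by
  obtain ⟨hmap, hcyc, hm, hQ⟩ := hT
  obtain ⟨c', hc'⟩ := hcyc.mintyMonotoneOn.exists_isSlopePotentialOn hK
    (hF.subset hmap.image_subset)
  exact hc'.ae_eq hP hF hQF hT' hPK hS hm (hT'.aemeasurable hP hfin hS) hQ hPQ

/-- A convex function that is affine on a dense subset of an open set has constant gradient
there. -/
theorem ConvexOn.gradient_eq_of_dense {C W G : Set (Rn n)} {φ : Rn n → ℝ} (hφ : ConvexOn ℝ C φ)
    (hW : IsOpen W) (hG : G ⊆ interior C) (hWG : W ⊆ closure (W ∩ G)) {a : Rn n} {γ : ℝ}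
    (hGφ : ∀ y ∈ W ∩ G, φ y = inner ℝ a y + γ) {x : Rn n} (hx : x ∈ W) : ∇ φ x = a := by
  have hne : (W ∩ G).Nonempty := closure_nonempty_iff.1 ⟨x, hWG hx⟩
  -- A convex set with nonempty interior has the same interior as its closure; this gives continuity
  -- of `φ` on `W`.
  have hWC : W ⊆ interior C := by
    rw [← hφ.1.interior_closure_eq_interior_of_nonempty_interior
      (hne.mono (inter_subset_right.trans hG))]
    exact interior_maximal (hWG.trans (closure_mono
      (inter_subset_right.trans (hG.trans interior_subset)))) hW
  have hcont : ContinuousOn φ W := hφ.continuousOn_interior.mono hWC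
  have heq : EqOn φ (fun y => inner ℝ a y + γ) W :=
    EqOn.of_subset_closure (s := W ∩ G) hGφ hcont (by fun_prop) inter_subset_left hWG
  have hg : HasGradientAt (fun y => inner ℝ a y + γ) a x := by
    rw [hasGradientAt_iff_hasFDerivAt]
    exact ((InnerProductSpace.toDual ℝ (Rn n) a).hasFDerivAt).add_const _
  exact (hg.congr_of_eventuallyEq (heq.eventuallyEq_of_mem (hW.mem_nhds hx))).gradient

end AlmostEverywhere

/-! ### Semidiscrete optimal transport by duality. -/

section Semidiscrete

variable {n : ℕ} {ι : Type*} [Fintype ι] [Nonempty ι]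

/-- The maximum of the affine functions `⟪a i, ·⟫ + c i`. -/
noncomputable def maxAffine (a : ι → Rn n) (c : ι → ℝ) (x : Rn n) : ℝ :=
  Finset.univ.sup' Finset.univ_nonempty fun i => inner ℝ (a i) x + c i

theorem le_maxAffine (a : ι → Rn n) (c : ι → ℝ) (x : Rn n) (i : ι) :
    inner ℝ (a i) x + c i ≤ maxAffine a c x :=
  Finset.le_sup' (fun i => inner ℝ (a i) x + c i) (Finset.mem_univ i)

theorem maxAffine_le {a : ι → Rn n} {c : ι → ℝ} {x : Rn n} {r : ℝ}
    (h : ∀ i, inner ℝ (a i) x + c i ≤ r) : maxAffine a c x ≤ r :=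
  Finset.sup'_le _ _ fun i _ => h i

theorem maxAffine_le_add {a : ι → Rn n} {c c' : ι → ℝ} {r : ℝ} (h : ∀ i, c i ≤ c' i + r)
    (x : Rn n) : maxAffine a c x ≤ maxAffine a c' x + r :=
  maxAffine_le fun i => by linarith [h i, le_maxAffine a c' x i]

theorem continuous_maxAffine (a : ι → Rn n) (c : ι → ℝ) : Continuous (maxAffine a c) :=
  Continuous.finset_sup'_apply _ fun i _ => by fun_prop

theorem abs_maxAffine_sub_le (a : ι → Rn n) (c c' : ι → ℝ) (x : Rn n) :
    |maxAffine a c x - maxAffine a c' x| ≤ ‖c - c'‖ := by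
  have h : ∀ i, |c i - c' i| ≤ ‖c - c'‖ := fun i => norm_le_pi_norm (c - c') i
  have h1 := maxAffine_le_add (a := a) (c := c) (c' := c') (r := ‖c - c'‖)
    (fun i => by linarith [(abs_le.1 (h i)).2]) x
  have h2 := maxAffine_le_add (a := a) (c := c') (c' := c) (r := ‖c - c'‖)
    (fun i => by linarith [(abs_le.1 (h i)).1]) x
  rw [abs_le]
  constructor <;> linarith

variable (P : Measure (Rn n)) [IsProbabilityMeasure P]

theorem integrable_maxAffine_sub (a : ι → Rn n) (c c' : ι → ℝ) :
    Integrable (fun x => maxAffine a c x - maxAffine a c' x) P :=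
  Integrable.of_bound
    ((continuous_maxAffine a c).sub (continuous_maxAffine a c')).aestronglyMeasurable ‖c - c'‖
    (Eventually.of_forall fun x => abs_maxAffine_sub_le a c c' x)

/-- The dual functional of semidiscrete optimal transport from `P` to the measure with masses `q i`
at `a i`, normalized so that it is finite without any moment assumption on `P`. -/
noncomputable def semidiscreteDual (a : ι → Rn n) (q c : ι → ℝ) : ℝ :=
  ∫ x, (maxAffine a c x - maxAffine a 0 x) ∂P - ∑ i, q i * c i

theorem semidiscreteDual_sub (a : ι → Rn n) (q c c' : ι → ℝ) :
    semidiscreteDual P a q c - semidiscreteDual P a q c' =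
      ∫ x, (maxAffine a c x - maxAffine a c' x) ∂P - ∑ i, q i * (c i - c' i) := by
  have h : ∫ x, (maxAffine a c x - maxAffine a c' x) ∂P =
      ∫ x, (maxAffine a c x - maxAffine a 0 x) ∂P -
        ∫ x, (maxAffine a c' x - maxAffine a 0 x) ∂P := by
    rw [← integral_sub (integrable_maxAffine_sub P a c 0) (integrable_maxAffine_sub P a c' 0)]
    simp
  simp only [semidiscreteDual, h, mul_sub, Finset.sum_sub_distrib]
  ring

theorem continuous_semidiscreteDual (a : ι → Rn n) (q : ι → ℝ) :
    Continuous (semidiscreteDual P a q) := by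
  refine Continuous.sub ?_ (by fun_prop)
  refine (LipschitzWith.of_dist_le_mul (K := 1) fun c c' => ?_).continuous
  rw [Real.dist_eq, ← integral_sub (integrable_maxAffine_sub P a c 0)
    (integrable_maxAffine_sub P a c' 0), NNReal.coe_one, one_mul, dist_eq_norm]
  have h := norm_integral_le_of_norm_le_const (μ := P) (C := ‖c - c'‖)
    (f := fun x => maxAffine a c x - maxAffine a c' x)
    (Eventually.of_forall fun x => abs_maxAffine_sub_le a c c' x)
  simpa using h

/-- Both measures have mass one, so the two shifts cancel; potentials may be normalized to have
maximum zero. -/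
theorem semidiscreteDual_sub_const (a : ι → Rn n) {q : ι → ℝ} (hq : ∑ i, q i = 1) (c : ι → ℝ)
    (r : ℝ) : semidiscreteDual P a q (fun i => c i - r) = semidiscreteDual P a q c := by
  have h : ∀ x, maxAffine a (fun i => c i - r) x - maxAffine a c x = -r := by
    intro x
    have h1 := maxAffine_le_add (a := a) (c := fun i => c i - r) (c' := c) (r := -r)
      (fun i => by simp [sub_eq_add_neg]) x
    have h2 := maxAffine_le_add (a := a) (c := c) (c' := fun i => c i - r) (r := r)
      (fun i => by simp) x
    linarith
  rw [← sub_eq_zero, semidiscreteDual_sub]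
  simp [h, ← Finset.sum_mul, hq]

/-- The dual functional is coercive on the normalized potentials. -/
theorem exists_semidiscreteDual_pos (a : ι → Rn n) {q : ι → ℝ} (hq : ∀ i, 0 < q i) :
    ∃ R : ℝ, 0 ≤ R ∧ ∀ c : ι → ℝ, (∀ i, c i ≤ 0) → (∃ i, c i = 0) → (∃ i, c i < -R) →
      0 < semidiscreteDual P a q c := by
  obtain ⟨j, hj⟩ := Finite.exists_min q
  set w : Rn n → ℝ := fun x => ∑ i, (maxAffine a 0 x - inner ℝ (a i) x) with hw
  have hwc : Continuous w := by
    have := continuous_maxAffine a 0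
    fun_prop
  have hterm : ∀ x i, 0 ≤ maxAffine a 0 x - inner ℝ (a i) x := by
    intro x i
    have := le_maxAffine a 0 x i
    simp only [Pi.zero_apply, add_zero] at this
    linarith
  obtain ⟨N, hN⟩ : ∃ N : ℕ, P.real {x | (N : ℝ) < w x} < q j / 2 := by
    have hanti : Antitone fun N : ℕ => {x | (N : ℝ) < w x} := fun N N' h x hx => by
      simp only [mem_ofPred_eq] at hx ⊢
      exact lt_of_le_of_lt (Nat.cast_le.2 h) hx
    have hlim := tendsto_measure_iInter_atTop (μ := P) (s := fun N : ℕ => {x | (N : ℝ) < w x})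
      (fun N => (isOpen_lt continuous_const hwc).measurableSet.nullMeasurableSet) hanti
      ⟨0, measure_ne_top _ _⟩
    have hempty : ⋂ N : ℕ, {x | (N : ℝ) < w x} = ∅ := by
      refine eq_empty_iff_forall_notMem.2 fun x hx => ?_
      obtain ⟨N, hN⟩ := exists_nat_gt (w x)
      exact lt_asymm hN (mem_iInter.1 hx N)
    rw [hempty, measure_empty] at hlim
    have hlim' := (ENNReal.tendsto_toReal ENNReal.zero_ne_top).comp hlim
    exact (hlim'.eventually_lt_const (by simpa using half_pos (hq j))).exists
  -- With `L = -min c`, the integral is at least `-N - P(B) L` and `P(B) < q j / 2`, while the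
  -- linear term gains at least `q j * L`. The total is positive once `L > 2 * N / q j`.
  refine ⟨2 * N / q j, by have := hq j; positivity, ?_⟩
  rintro c hc ⟨i₀, hi₀⟩ ⟨i₁, hi₁⟩
  obtain ⟨l, hl⟩ := Finite.exists_min c
  set L : ℝ := -c l with hL
  have hLpos : 2 * N / q j < L := by linarith [hl i₁]
  rw [div_lt_iff₀ (hq j)] at hLpos
  have hL0 : 0 ≤ L := by linarith [hc l]
  set B : Set (Rn n) := {x | (N : ℝ) < w x} with hB
  have hBm : MeasurableSet B := (isOpen_lt continuous_const hwc).measurableSet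
  have hpt : ∀ x, -(N : ℝ) + B.indicator (fun _ => -L) x ≤ maxAffine a c x - maxAffine a 0 x := by
    intro x
    by_cases hx : x ∈ B
    · rw [indicator_of_mem hx]
      have := maxAffine_le_add (a := a) (c := 0) (c' := c) (r := L)
        (fun i => by simp only [Pi.zero_apply]; linarith [hl i]) x
      have : (0 : ℝ) ≤ N := Nat.cast_nonneg N
      linarith
    · rw [indicator_of_notMem hx]
      have h1 := le_maxAffine a c x i₀
      have h2 : maxAffine a 0 x - inner ℝ (a i₀) x ≤ w x :=
        Finset.single_le_sum (f := fun i => maxAffine a 0 x - inner ℝ (a i) x)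
          (fun i _ => hterm x i) (Finset.mem_univ i₀)
      have h3 : w x ≤ N := not_lt.1 hx
      linarith
  have hiB : Integrable (B.indicator fun _ => -L) P := (integrable_const _).indicator hBm
  have hint := integral_mono ((integrable_const (-(N : ℝ))).add hiB)
    (integrable_maxAffine_sub P a c 0) hpt
  have hval : ∫ x, (-(N : ℝ) + B.indicator (fun _ => -L) x) ∂P = -N - P.real B * L := by
    rw [integral_add (integrable_const _) hiB, integral_indicator hBm]
    simp [sub_eq_add_neg]
  have hint' : -N - P.real B * L ≤ ∫ x, (maxAffine a c x - maxAffine a 0 x) ∂P := hval ▸ hint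
  have hsum : q j * L ≤ -∑ i, q i * c i := by
    rw [← Finset.sum_neg_distrib]
    calc q j * L ≤ q l * L := mul_le_mul_of_nonneg_right (hj l) hL0
      _ = -(q l * c l) := by rw [hL]; ring
      _ ≤ ∑ i, -(q i * c i) := Finset.single_le_sum (f := fun i => -(q i * c i))
          (fun i _ => by nlinarith [hq i, hc i]) (Finset.mem_univ l)
  have hBL : P.real B * L ≤ q j / 2 * L := mul_le_mul_of_nonneg_right hN.le hL0
  rw [semidiscreteDual]
  linarith

/-- A minimizer over a compact box is global: normalized competitors outside the box have positive
value, whereas the zero potential has value zero. -/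
theorem exists_forall_semidiscreteDual_le (a : ι → Rn n) {q : ι → ℝ} (hq : ∀ i, 0 < q i)
    (hq1 : ∑ i, q i = 1) :
    ∃ c, ∀ c', semidiscreteDual P a q c ≤ semidiscreteDual P a q c' := by
  obtain ⟨R, hR, hpos⟩ := exists_semidiscreteDual_pos P a hq
  have h0mem : (0 : ι → ℝ) ∈ Icc (fun _ => -R) (0 : ι → ℝ) :=
    ⟨fun i => by simpa using hR, le_rfl⟩
  obtain ⟨c, -, hc⟩ := (isCompact_Icc (a := fun _ : ι => -R) (b := (0 : ι → ℝ))).exists_isMinOn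
    ⟨0, h0mem⟩ (continuous_semidiscreteDual P a q).continuousOn
  refine ⟨c, fun c' => ?_⟩
  obtain ⟨l, hl⟩ := Finite.exists_max c'
  rw [← semidiscreteDual_sub_const P a hq1 c' (c' l)]
  by_cases hbox : ∃ i, c' i - c' l < -R
  · have h1 := hpos (fun i => c' i - c' l) (fun i => by linarith [hl i]) ⟨l, sub_self _⟩ hbox
    have h2 : semidiscreteDual P a q c ≤ semidiscreteDual P a q 0 := hc h0mem
    have h3 : semidiscreteDual P a q 0 = 0 := by simp [semidiscreteDual]
    linarith
  · push Not at hbox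
    exact hc ⟨hbox, fun i => by simpa using hl i⟩

/-- First-order optimality: raising one weight by `ε` raises the maximum by at most `ε`, and only
where slope `i` is within `ε` of maximal. So the `ε`-cell has mass at least `q i`; then `ε → 0`. -/
theorem exists_forall_le_measure_cell (a : ι → Rn n) {q : ι → ℝ} (hq : ∀ i, 0 < q i)
    (hq1 : ∑ i, q i = 1) :
    ∃ c : ι → ℝ, ∀ i,
      ENNReal.ofReal (q i) ≤ P {x | ∀ j, inner ℝ (a j) x + c j ≤ inner ℝ (a i) x + c i} := by
  classical
  obtain ⟨c, hc⟩ := exists_forall_semidiscreteDual_le P a hq hq1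
  refine ⟨c, fun i => ?_⟩
  set A : ℝ → Set (Rn n) := fun ε => {x | maxAffine a c x ≤ inner ℝ (a i) x + c i + ε} with hA
  have hAm : ∀ ε, MeasurableSet (A ε) := fun ε =>
    (isClosed_le (continuous_maxAffine a c) (by fun_prop)).measurableSet
  have hle : ∀ ε > 0, ENNReal.ofReal (q i) ≤ P (A ε) := by
    intro ε hε
    set c' : ι → ℝ := Function.update c i (c i + ε) with hc'
    have hpt : ∀ x, maxAffine a c' x - maxAffine a c x ≤ (A ε).indicator (fun _ => ε) x := by
      intro x
      by_cases hx : x ∈ A ε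
      · rw [indicator_of_mem hx]
        have := maxAffine_le_add (a := a) (c := c') (c' := c) (r := ε) (fun j => by
          by_cases hj : j = i
          · subst hj; simp [hc']
          · rw [hc', Function.update_of_ne hj]; linarith) x
        linarith
      · rw [indicator_of_notMem hx, sub_nonpos]
        refine maxAffine_le fun j => ?_
        by_cases hj : j = i
        · subst hj
          rw [hc', Function.update_self, ← add_assoc]
          exact (not_le.1 hx).le
        · rw [hc', Function.update_of_ne hj]
          exact le_maxAffine a c x j
    have h1 := integral_mono (integrable_maxAffine_sub P a c' c)
      ((integrable_const ε).indicator (hAm ε)) hpt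
    rw [integral_indicator (hAm ε), setIntegral_const, smul_eq_mul] at h1
    have h2 := semidiscreteDual_sub P a q c' c
    have h3 : ∑ j, q j * (c' j - c j) = q i * ε := by
      rw [Finset.sum_eq_single i]
      · simp [hc']
      · intro j _ hj
        rw [hc', Function.update_of_ne hj, sub_self, mul_zero]
      · simp
    have h4 := hc c'
    have h5 : q i * ε ≤ P.real (A ε) * ε := by linarith
    exact ENNReal.ofReal_le_of_le_toReal (le_of_mul_le_mul_right h5 hε)
  have hinter : ⋂ k : ℕ, A (1 / ((k : ℝ) + 1)) =
      {x | ∀ j, inner ℝ (a j) x + c j ≤ inner ℝ (a i) x + c i} := by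
    ext x
    simp only [mem_iInter, mem_ofPred_eq, hA]
    constructor
    · intro h j
      refine (le_maxAffine a c x j).trans ?_
      have hlim : Tendsto (fun k : ℕ => inner ℝ (a i) x + c i + 1 / ((k : ℝ) + 1)) atTop
          (𝓝 (inner ℝ (a i) x + c i + 0)) := tendsto_one_div_add_atTop_nhds_zero_nat.const_add _
      rw [add_zero] at hlim
      exact ge_of_tendsto' hlim h
    · intro h k
      have : (0 : ℝ) ≤ 1 / ((k : ℝ) + 1) := by positivity
      exact (maxAffine_le h).trans (by linarith)
  have hanti : Antitone fun k : ℕ => A (1 / ((k : ℝ) + 1)) := by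
    intro k l hkl x hx
    have hkl' : 1 / ((l : ℝ) + 1) ≤ 1 / ((k : ℝ) + 1) := Nat.one_div_le_one_div hkl
    simp only [hA, mem_ofPred_eq] at hx ⊢
    linarith
  have hlim := tendsto_measure_iInter_atTop (μ := P)
    (fun k : ℕ => (hAm (1 / ((k : ℝ) + 1))).nullMeasurableSet) hanti ⟨0, measure_ne_top _ _⟩
  rw [hinter] at hlim
  exact ge_of_tendsto' hlim fun k => hle _ (by positivity)

/-- Semidiscrete optimal transport: an absolutely continuous probability measure can be pushed to
any finitely supported one by a map with a slope potential. -/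
theorem exists_isSlopePotentialOn_map_eq (hP : P ≪ volume) (Q : Measure (Rn n))
    [IsProbabilityMeasure Q] {F : Set (Rn n)} (hF : F.Finite) (hQF : Q Fᶜ = 0) :
    ∃ (T : Rn n → Rn n) (c : Rn n → ℝ), (∀ x, T x ∈ F) ∧ IsSlopePotentialOn T c univ ∧
      P.map T = Q := by
  classical
  set A : Finset (Rn n) := hF.toFinset.filter fun a => Q {a} ≠ 0 with hA
  have hAF : ∀ a ∈ A, a ∈ F := fun a ha => hF.mem_toFinset.1 (Finset.mem_filter.1 ha).1
  have hQA : Q (A : Set (Rn n))ᶜ = 0 := by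
    have hsub : (A : Set (Rn n))ᶜ ⊆ Fᶜ ∪ ⋃ a ∈ F \ A, {a} := by
      intro a ha
      by_cases haF : a ∈ F
      · exact Or.inr (mem_biUnion (x := a) ⟨haF, ha⟩ rfl)
      · exact Or.inl haF
    refine measure_mono_null hsub (measure_union_null hQF ?_)
    refine (measure_biUnion_null_iff (hF.subset sdiff_subset).countable).2 fun a ha => ?_
    by_contra h
    exact ha.2 (Finset.mem_filter.2 ⟨hF.mem_toFinset.2 ha.1, h⟩)
  have hQA1 : ∑ a ∈ A, Q {a} = 1 := by
    rw [sum_measure_singleton, ← prob_compl_eq_zero_iff A.measurableSet]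
    exact hQA
  have hne : A.Nonempty := by
    rw [Finset.nonempty_iff_ne_empty]
    intro h
    simp [h] at hQA1
  have : Nonempty A := hne.to_subtype
  obtain ⟨c, hc⟩ := exists_forall_le_measure_cell P (fun i : A => (i : Rn n))
    (q := fun i => Q.real {(i : Rn n)})
    (fun i => ENNReal.toReal_pos (Finset.mem_filter.1 i.2).2 (measure_ne_top _ _)) (by
      rw [Finset.sum_coe_sort A fun a => Q.real {a}]
      simp only [Measure.real]
      rw [← ENNReal.toReal_sum fun a _ => measure_ne_top _ _, hQA1, ENNReal.toReal_one])
  set c' : Rn n → ℝ := fun a => if h : a ∈ A then c ⟨a, h⟩ else 0 with hc'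
  have hex : ∀ x : Rn n, ∃ a ∈ A, ∀ b ∈ A, inner ℝ b x + c' b ≤ inner ℝ a x + c' a :=
    fun x => Finset.exists_max_image A (fun a => inner ℝ a x + c' a) hne
  choose T hTA hTmax using hex
  have hT : IsSlopePotentialOn T c' univ := fun x _ y _ => hTmax x _ (hTA y)
  have hfin : (T '' univ).Finite := A.finite_toSet.subset (by rintro _ ⟨x, -, rfl⟩; exact hTA x)
  have hTm : AEMeasurable T P := hT.aemeasurable hP hfin (by simp)
  have hcell : ∀ a ∈ A, Q {a} ≤ P.map T {a} := by
    intro a ha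
    rw [Measure.map_apply_of_aemeasurable hTm (measurableSet_singleton a)]
    have h1 := hc ⟨a, ha⟩
    simp only [Measure.real, ENNReal.ofReal_toReal (measure_ne_top Q _)] at h1
    refine h1.trans (measure_mono_ae ?_)
    filter_upwards [hP.ae_le (ae_forall_ne_inner_ne A.finite_toSet c')] with x hx hxa
    by_contra hne
    refine hx _ (hTA x) a ha hne (le_antisymm ?_ (hTmax x a ha))
    have h2 := hxa ⟨T x, hTA x⟩
    simpa [hc', ha, hTA x] using h2
  have : IsProbabilityMeasure (P.map T) := Measure.isProbabilityMeasure_map hTm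
  -- Domination at the atoms suffices, and domination between probability measures is equality.
  have hle : Q ≤ P.map T := by
    refine Measure.le_iff.2 fun s hs => ?_
    calc Q s ≤ Q ((A.filter (· ∈ s) : Finset (Rn n)) ∪ (A : Set (Rn n))ᶜ) :=
          measure_mono fun x hx => by
            by_cases hxA : x ∈ A
            · exact Or.inl (Finset.mem_coe.2 (Finset.mem_filter.2 ⟨hxA, hx⟩))
            · exact Or.inr hxA
      _ ≤ Q (A.filter (· ∈ s) : Finset (Rn n)) + Q (A : Set (Rn n))ᶜ := measure_union_le _ _
      _ = ∑ a ∈ A.filter (· ∈ s), Q {a} := by rw [hQA, add_zero, sum_measure_singleton]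
      _ ≤ ∑ a ∈ A.filter (· ∈ s), P.map T {a} :=
          Finset.sum_le_sum fun a ha => hcell a (Finset.mem_filter.1 ha).1
      _ = P.map T (A.filter (· ∈ s) : Finset (Rn n)) := sum_measure_singleton
      _ ≤ P.map T s := measure_mono fun x hx => (Finset.mem_filter.1 (Finset.mem_coe.1 hx)).2
  exact ⟨T, c', fun x => hAF _ (hTA x), hT, (Measure.eq_of_le_of_isProbabilityMeasure hle).symm⟩

end Semidiscrete

/-! ### Extending the drift by closure of its graph. -/

section Selection

variable {n : ℕ}

/-- On `K`, the map `d` takes values in `F` and its graph lies in the closure of the graph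
`{(h u, g u)}`, taken in the first variable only. -/
def IsClosureSelectionOn (h g : Rn n → Rn n) (F K : Set (Rn n)) (d : Rn n → Rn n) : Prop :=
  ∀ x ∈ K, d x ∈ F ∧ x ∈ closure (h '' (g ⁻¹' {d x}))

theorem exists_isClosureSelectionOn {h g : Rn n → Rn n} {F K : Set (Rn n)} (hF : F.Finite)
    (hK : K ⊆ closure (h '' (g ⁻¹' F))) : ∃ d, IsClosureSelectionOn h g F K d := by
  have hex : ∀ x ∈ K, ∃ a, a ∈ F ∧ x ∈ closure (h '' (g ⁻¹' {a})) := by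
    intro x hx
    have h1 := hK hx
    have h2 : h '' (g ⁻¹' F) = ⋃ a ∈ F, h '' (g ⁻¹' {a}) := by
      simp only [← image_iUnion, ← preimage_iUnion, biUnion_of_singleton]
    rw [h2, hF.closure_biUnion] at h1
    simpa using h1
  choose! d hd using hex
  exact ⟨d, hd⟩

theorem inner_nonneg_of_mem_closure {h g : Rn n → Rn n} {x a b : Rn n}
    (hx : ∀ u, 0 ≤ inner ℝ (x - h u) (b - g u)) {y : Rn n}
    (hy : y ∈ closure (h '' (g ⁻¹' {a}))) : 0 ≤ inner ℝ (x - y) (b - a) := by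
  have hcl : IsClosed {y | 0 ≤ inner ℝ (x - y) (b - a)} :=
    isClosed_le continuous_const (by fun_prop)
  refine closure_minimal ?_ hcl hy
  rintro _ ⟨u, rfl, rfl⟩
  exact hx u

variable {h g : Rn n → Rn n} {F K : Set (Rn n)} {d : Rn n → Rn n}

theorem CoMonotone.inner_nonneg_of_mem_closure (hco : CoMonotone h g) {x a : Rn n}
    (hx : x ∈ closure (h '' (g ⁻¹' {a}))) (u : Rn n) : 0 ≤ inner ℝ (x - h u) (a - g u) := by
  have := _root_.inner_nonneg_of_mem_closure (hco u) hx
  rwa [← neg_sub x, ← neg_sub a, inner_neg_neg] at this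

/-- Co-monotonicity passes to the closure in one argument, then in the other. -/
theorem IsClosureSelectionOn.mintyMonotoneOn (hd : IsClosureSelectionOn h g F K d)
    (hco : CoMonotone h g) : MintyMonotoneOn d K := fun x hx y hy =>
  inner_nonneg_of_mem_closure (hco.inner_nonneg_of_mem_closure (hd x hx).2) (hd y hy).2

theorem IsClosureSelectionOn.exists_isSlopePotentialOn (hd : IsClosureSelectionOn h g F K d)
    (hco : CoMonotone h g) (hF : F.Finite) (hK : Convex ℝ K) : ∃ c, IsSlopePotentialOn d c K :=
  (hd.mintyMonotoneOn hco).exists_isSlopePotentialOn hK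
    (hF.subset (by rintro _ ⟨x, hx, rfl⟩; exact (hd x hx).1))

/-- A closure selection of a co-monotone pair is locally constant almost everywhere. -/
theorem IsClosureSelectionOn.ae_exists_isOpen (hd : IsClosureSelectionOn h g F K d)
    (hco : CoMonotone h g) (hF : F.Finite) (hK : Convex ℝ K) :
    ∀ᵐ x : Rn n, x ∈ K → ∃ W, IsOpen W ∧ x ∈ W ∧ W ⊆ K ∧ ∀ y ∈ W, d y = d x := by
  have hsep : ∀ᵐ x : Rn n, ∀ a ∈ F, ∀ b ∈ F, a ≠ b →
      x ∈ closure (h '' (g ⁻¹' {a})) → x ∉ closure (h '' (g ⁻¹' {b})) := by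
    refine (ae_ball_iff hF.countable).2 fun a _ => (ae_ball_iff hF.countable).2 fun b _ => ?_
    by_cases hab : a = b
    · exact Eventually.of_forall fun x h => absurd hab h
    rcases (closure (h '' (g ⁻¹' {a})) ∩ closure (h '' (g ⁻¹' {b}))).eq_empty_or_nonempty with
      he | ⟨z, hza, hzb⟩
    · exact Eventually.of_forall fun x _ hxa hxb => (he ▸ ⟨hxa, hxb⟩ : x ∈ (∅ : Set (Rn n)))
    -- For two common points `x` and `z`, monotonicity used both ways forces `⟪a - b, x - z⟫ = 0`,
    -- so the overlap of the closures lies in a hyperplane.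
    · have h0 := volume_hyperplane_eq_zero (sub_ne_zero.2 hab) (inner ℝ (a - b) z)
      filter_upwards [measure_eq_zero_iff_ae_notMem.1 h0] with x hx _ hxa hxb
      refine hx ?_
      have h1 := inner_nonneg_of_mem_closure (hco.inner_nonneg_of_mem_closure hxa) hzb
      have h2 := inner_nonneg_of_mem_closure (hco.inner_nonneg_of_mem_closure hza) hxb
      rw [real_inner_comm, inner_sub_right] at h1 h2
      exact le_antisymm (by linarith) (by linarith)
  have hfr : ∀ᵐ x : Rn n, x ∉ frontier K :=
    measure_eq_zero_iff_ae_notMem.1 (hK.addHaar_frontier volume)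
  filter_upwards [hsep, hfr] with x hx hxfr hxK
  have hxint : x ∈ interior K := by
    by_contra hcon
    exact hxfr ⟨subset_closure hxK, hcon⟩
  refine ⟨interior K ∩ (⋃ b ∈ F \ {d x}, closure (h '' (g ⁻¹' {b})))ᶜ, ?_, ⟨hxint, ?_⟩,
    inter_subset_left.trans interior_subset, ?_⟩
  · exact isOpen_interior.inter
      ((hF.subset sdiff_subset).isClosed_biUnion fun b _ => isClosed_closure).isOpen_compl
  · intro hcon
    obtain ⟨b, hb, hxb⟩ := mem_iUnion₂.1 hcon
    exact hx _ (hd x hxK).1 b hb.1 (fun e => hb.2 e.symm) (hd x hxK).2 hxb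
  · rintro y ⟨hyK, hyn⟩
    by_contra hne
    have hy := hd y (interior_subset hyK)
    exact hyn (mem_biUnion (x := d y) ⟨hy.1, hne⟩ hy.2)

/-- Almost everywhere on `K`, a closure selection takes the only value that is compatible with the
graph `{(h u, g u)}`. -/
theorem IsClosureSelectionOn.ae_eq_of_inner_nonneg (hd : IsClosureSelectionOn h g F K d)
    (hco : CoMonotone h g) (hF : F.Finite) (hK : Convex ℝ K) :
    ∀ᵐ x : Rn n, x ∈ K → ∀ a, (∀ u, 0 ≤ inner ℝ (x - h u) (a - g u)) → a = d x := by
  filter_upwards [hd.ae_exists_isOpen hco hF hK] with x hx hxK a ha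
  obtain ⟨W, hW, hxW, hWK, hWd⟩ := hx hxK
  -- A small move from `x` towards `a - d x` keeps the value `d x`; compatibility of `a` at `x` then
  -- reads `-t * ‖a - d x‖ ^ 2 ≥ 0`.
  have hcont : Tendsto (fun t : ℝ => x + t • (a - d x)) (𝓝[>] 0) (𝓝 x) := by
    have : Continuous fun t : ℝ => x + t • (a - d x) := by fun_prop
    simpa using (this.tendsto 0).mono_left nhdsWithin_le_nhds
  obtain ⟨t, htW, ht⟩ :=
    ((hcont.eventually (hW.mem_nhds hxW)).and self_mem_nhdsWithin).exists
  have hcl := (hd _ (hWK htW)).2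
  rw [hWd _ htW] at hcl
  have h1 := inner_nonneg_of_mem_closure ha hcl
  rw [sub_add_cancel_left, inner_neg_left, real_inner_smul_left, real_inner_self_eq_norm_sq] at h1
  have ht' : (0 : ℝ) < t := ht
  have h2 : ‖a - d x‖ ^ 2 ≤ 0 := by
    by_contra hcon
    have := mul_pos ht' (not_le.1 hcon)
    linarith
  have h3 : ‖a - d x‖ = 0 := pow_eq_zero_iff two_ne_zero |>.1 (le_antisymm h2 (sq_nonneg _))
  exact sub_eq_zero.1 (norm_eq_zero.1 h3)

theorem IsSupportedOn.ae_mem {μ : Measure (Rn n)} (hμ : IsSupportedOn μ K) : ∀ᵐ x ∂μ, x ∈ K :=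
  mem_ae_iff.2 hμ.1

theorem IsSupportedOn.subset_closure_of_ae {μ : Measure (Rn n)} (hμ : IsSupportedOn μ K)
    {W D : Set (Rn n)} (hW : IsOpen W) (hWK : W ⊆ K) (hD : ∀ᵐ x ∂μ, x ∈ D) :
    W ⊆ closure (W ∩ D) := by
  intro x hx
  refine mem_closure_iff.2 fun U hU hxU => ?_
  have hpos := (Measure.mem_support_iff_forall x).1 (hμ.2 (hWK hx)) (U ∩ W)
    ((hU.inter hW).mem_nhds ⟨hxU, hx⟩)
  have hex : ∃ y ∈ U ∩ W, y ∈ D := by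
    by_contra! hcon
    exact hpos.ne' (measure_mono_null (fun y hy => hcon y hy) (mem_ae_iff.1 hD))
  obtain ⟨y, hy, hyD⟩ := hex
  exact ⟨y, hy.1, hy.2, hyD⟩

/-- This is what lets the selection exist at every point of `K`, not merely almost everywhere. -/
theorem IsSupportedOn.subset_closure_image {ν : Measure (Rn n)} (hm : Measurable h)
    (hg : Measurable g) (hν : IsSupportedOn (ν.map h) K) (hF : F.Finite)
    (hgF : ν.map g Fᶜ = 0) : K ⊆ closure (h '' (g ⁻¹' F)) := by
  intro x hx
  refine mem_closure_iff.2 fun U hU hxU => ?_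
  have hpos := (Measure.mem_support_iff_forall x).1 (hν.2 hx) U (hU.mem_nhds hxU)
  rw [Measure.map_apply hm hU.measurableSet] at hpos
  rw [Measure.map_apply hg hF.measurableSet.compl] at hgF
  have : ∃ u ∈ h ⁻¹' U, g u ∈ F := by
    by_contra! hcon
    exact hpos.ne' (measure_mono_null (fun u hu => hcon u hu) hgF)
  obtain ⟨u, hu, huF⟩ := this
  exact ⟨h u, hu, u, huF, rfl⟩

/-- The gradient of a potential that agrees almost everywhere with `d` for a measure whose support
contains `K` agrees with `d` Lebesgue-almost everywhere on `K`. -/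
theorem IsClosureSelectionOn.ae_gradient_eq (hd : IsClosureSelectionOn h g F K d)
    (hco : CoMonotone h g) (hF : F.Finite) (hK : Convex ℝ K) {P Q : Measure (Rn n)}
    (hPK : IsSupportedOn P K) {C : Set (Rn n)} {φ : Rn n → ℝ} (hφ : IsBrenierPotential P Q C φ)
    (hφd : ∇ φ =ᵐ[P] d) : ∀ᵐ x : Rn n, x ∈ K → ∇ φ x = d x := by
  obtain ⟨c, S, -, hS, hSdef, hcφ⟩ := hφ.exists_isSlopePotentialOn
  filter_upwards [hd.ae_exists_isOpen hco hF hK] with x hx hxK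
  obtain ⟨W, hW, hxW, hWK, hWd⟩ := hx hxK
  refine hφ.1.gradient_eq_of_dense (G := {y | y ∈ S ∧ ∇ φ y = d y}) (γ := c (d x)) hW ?_
    (hPK.subset_closure_of_ae hW hWK (hS.and hφd)) ?_ hxW
  · rintro y ⟨hy, -⟩
    rw [hSdef] at hy
    exact hy.1
  · rintro y ⟨hyW, hyS, hyd⟩
    have := hcφ y hyS
    rw [hyd, hWd y hyW] at this
    linarith

end Selection

/-! ### Assembly. -/

theorem theorem3 {n : ℕ}
    -- latent laws and production functions
    (ν νs : Measure (Rn n)) [IsProbabilityMeasure ν] [IsProbabilityMeasure νs]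
    (h0 h1 h1s : Rn n → Rn n)
    (hm0 : Measurable h0) (hm1 : Measurable h1) (hm1s : Measurable h1s)
    -- laws of the outcomes
    (μ0 μ1 μ0s μ1s μ1d : Measure (Rn n))
    (hμ0 : μ0 = ν.map h0) (hμ1 : μ1 = ν.map h1)
    (hμ0s : μ0s = νs.map h0) (hμ1s : μ1s = νs.map h1s) (hμ1d : μ1d = νs.map h1)
    (K0 K0s F1 F1d : Set (Rn n))
    -- (A.1)
    (hK0 : Convex ℝ K0) (hμK0 : IsSupportedOn μ0 K0) (hac0 : μ0 ≪ volume)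
    (hK0s : Convex ℝ K0s) (hμK0s : IsSupportedOn μ0s K0s) (hac0s : μ0s ≪ volume)
    -- (A.2)
    (hF1 : F1.Finite) (hμF1 : μ1 F1ᶜ = 0) (hF1d : F1d.Finite) (hμF1d : μ1d F1dᶜ = 0)
    -- (A.3)
    (hco : CoMonotone h0 h1) (hwd : CompInvWellDefined h1 h0) :
    (∃ d : Rn n → Rn n,
      -- `d` is the natural drift `h1 ∘ h0⁻¹`, in the control and in the treatment group
      (∀ᵐ u ∂ν, d (h0 u) = h1 u) ∧ (∀ᵐ u ∂νs, d (h0 u) = h1 u) ∧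
      -- `d : K0s → F1d` pushes `μ0s` to `μ1d`, and is the unique such map
      IsMonotoneTransportOn μ0s μ1d K0s F1d d ∧
      (∀ d', IsMonotoneTransportOn μ0s μ1d K0s F1d d' → d' =ᵐ[μ0s] d) ∧
      IsBrenierMap μ0s μ1d d ∧
      -- `d` is the Brenier map from `μ0` to `μ1`, and on `K0` also `μ0s`-almost everywhere
      IsBrenierMap μ0 μ1 d ∧
      (∀ C φ, IsBrenierPotential μ0 μ1 C φ → ∀ᵐ x ∂μ0s, x ∈ K0 → ∇ φ x = d x)) ∧
    (∀ K1s : Set (Rn n),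
      -- (A.4)
      CoMonotone h0 h1s → CompInvWellDefined h1s h0 →
      -- (A.5)
      Convex ℝ K1s → IsSupportedOn μ1s K1s → μ1s ≪ volume →
      ∃ T : Rn n → Rn n,
        IsMonotoneTransportOn μ1s μ1d K1s F1d T ∧
        (∀ T', IsMonotoneTransportOn μ1s μ1d K1s F1d T' → T' =ᵐ[μ1s] T) ∧
        IsBrenierMap μ1s μ1d T) := by
  subst hμ0 hμ1 hμ0s hμ1s hμ1d
  have hP0 : IsProbabilityMeasure (ν.map h0) := Measure.isProbabilityMeasure_map hm0.aemeasurable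
  have hP0s : IsProbabilityMeasure (νs.map h0) := Measure.isProbabilityMeasure_map hm0.aemeasurable
  have hP1s : IsProbabilityMeasure (νs.map h1s) :=
    Measure.isProbabilityMeasure_map hm1s.aemeasurable
  have hP1d : IsProbabilityMeasure (νs.map h1) := Measure.isProbabilityMeasure_map hm1.aemeasurable
  refine ⟨?_, fun K1s _ _ hK1s hμK1s hac1s => ?_⟩
  · classical
    obtain ⟨d0, hd0⟩ := exists_isClosureSelectionOn hF1
      (hμK0.subset_closure_image hm0 hm1 hF1 hμF1)
    obtain ⟨ds, hds⟩ := exists_isClosureSelectionOn hF1d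
      (hμK0s.subset_closure_image hm0 hm1 hF1d hμF1d)
    -- On `K0s` the requirements are pointwise, so `ds` has priority there; on `K0` agreement with
    -- `d0` almost everywhere is enough.
    set d : Rn n → Rn n := fun x => if x ∈ K0s then ds x else d0 x with hd
    have hdK0s : ∀ x ∈ K0s, d x = ds x := fun x hx => if_pos hx
    have hcompat : ∀ x, x ∈ K0 ∨ x ∈ K0s → ∀ u, 0 ≤ inner ℝ (x - h0 u) (d x - h1 u) := by
      intro x hx
      by_cases hxs : x ∈ K0s
      · rw [hdK0s x hxs]
        exact hco.inner_nonneg_of_mem_closure (hds x hxs).2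
      · rw [hd]
        simp only [if_neg hxs]
        exact hco.inner_nonneg_of_mem_closure (hd0 x (hx.resolve_right hxs)).2
    have hae0 := hd0.ae_eq_of_inner_nonneg hco hF1 hK0
    have haes := hds.ae_eq_of_inner_nonneg hco hF1d hK0s
    have hdd0 : ∀ᵐ x : Rn n, x ∈ K0 → d x = d0 x := by
      filter_upwards [hae0] with x hx hxK using hx hxK _ (hcompat x (Or.inl hxK))
    have huniq : ∀ᵐ x : Rn n, x ∈ K0 ∨ x ∈ K0s → ∀ u, h0 u = x → d x = h1 u := by
      filter_upwards [hae0, haes, hdd0] with x h1x h2x h3x hxK u hu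
      -- By co-monotonicity `h1 u` is itself compatible with the graph at `h0 u`, hence is the
      -- unique such value.
      have hu' : ∀ v, 0 ≤ inner ℝ (x - h0 v) (h1 u - h1 v) := fun v => hu ▸ hco u v
      by_cases hxs : x ∈ K0s
      · rw [hdK0s x hxs, h2x hxs _ hu']
      · have hx0 := hxK.resolve_right hxs
        rw [h3x hx0, h1x hx0 _ hu']
    have hν : ∀ᵐ u ∂ν, d (h0 u) = h1 u := by
      have h := ae_of_ae_map hm0.aemeasurable
        (Eventually.and (hac0.ae_le huniq) hμK0.ae_mem)
      filter_upwards [h] with u hu using hu.1 (Or.inl hu.2) u rfl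
    have hνs : ∀ᵐ u ∂νs, d (h0 u) = h1 u := by
      have h := ae_of_ae_map hm0.aemeasurable
        (Eventually.and (hac0s.ae_le huniq) hμK0s.ae_mem)
      filter_upwards [h] with u hu using hu.1 (Or.inr hu.2) u rfl
    have hfins : (d '' K0s).Finite := hF1d.subset (by
      rintro _ ⟨x, hx, rfl⟩
      rw [hdK0s x hx]
      exact (hds x hx).1)
    have hfin0 : (d0 '' K0).Finite := hF1.subset (by
      rintro _ ⟨x, hx, rfl⟩
      exact (hd0 x hx).1)
    obtain ⟨c0, hc0⟩ := hd0.exists_isSlopePotentialOn hco hF1 hK0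
    obtain ⟨cs, hcs⟩ := hds.exists_isSlopePotentialOn hco hF1d hK0s
    have hcs' : IsSlopePotentialOn d cs K0s := by
      intro x hx y hy
      rw [hdK0s x hx, hdK0s y hy]
      exact hcs x hx y hy
    have hdd0' : d =ᵐ[ν.map h0] d0 := by
      filter_upwards [hac0.ae_le hdd0, hμK0.ae_mem] with x hx hxK using hx hxK
    have hms : AEMeasurable d (νs.map h0) := hcs'.aemeasurable hac0s hfins hμK0s.ae_mem
    have hm0' : AEMeasurable d0 (ν.map h0) := hc0.aemeasurable hac0 hfin0 hμK0.ae_mem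
    have hmaps : (νs.map h0).map d = νs.map h1 := by
      rw [AEMeasurable.map_map_of_aemeasurable hms hm0.aemeasurable]
      exact Measure.map_congr hνs
    have hmap0 : (ν.map h0).map d0 = ν.map h1 := by
      rw [← Measure.map_congr hdd0', AEMeasurable.map_map_of_aemeasurable
        (hm0'.congr hdd0'.symm) hm0.aemeasurable]
      exact Measure.map_congr hν
    have hB0 := hc0.isBrenierMap hac0 hF1 hμF1 hfin0 hμK0.ae_mem hmap0
    refine ⟨d, hν, hνs, ⟨fun x hx => ?_, hcs'.cyclicallyMonotoneOn, hms, hmaps⟩, fun d' hd' => ?_,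
      hcs'.isBrenierMap hac0s hF1d hμF1d hfins hμK0s.ae_mem hmaps, ?_, fun C φ hφ => ?_⟩
    · rw [hdK0s x hx]
      exact (hds x hx).1
    · exact hd'.ae_eq hac0s hK0s hμK0s.ae_mem hF1d hμF1d hcs' hfins hμK0s.ae_mem hmaps
    · obtain ⟨⟨C, φ, hφ, hφd⟩, hun⟩ := hB0
      exact ⟨⟨C, φ, hφ, hdd0'.trans hφd⟩, fun S hS => (hun S hS).trans hdd0'.symm⟩
    · have hφd : ∇ φ =ᵐ[ν.map h0] d0 := hB0.2 _ ⟨C, φ, hφ, EventuallyEq.rfl⟩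
      -- Upgrading the identity from the control law to Lebesgue measure on `K0` is what allows the
      -- passage to the treated law.
      have h := hd0.ae_gradient_eq hco hF1 hK0 hμK0 hφ hφd
      filter_upwards [hac0s.ae_le h, hac0s.ae_le hdd0] with x hx1 hx2 hxK
      rw [hx1 hxK, hx2 hxK]
  · obtain ⟨T, c, hTF, hT, hTQ⟩ := exists_isSlopePotentialOn_map_eq (νs.map h1s) hac1s
      (νs.map h1) hF1d hμF1d
    have hfin : (T '' univ).Finite := hF1d.subset (by rintro _ ⟨x, -, rfl⟩; exact hTF x)
    have hmem : ∀ᵐ x ∂νs.map h1s, x ∈ (univ : Set (Rn n)) := by simp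
    refine ⟨T, ⟨fun x _ => hTF x, ?_, hT.aemeasurable hac1s hfin hmem, hTQ⟩, fun T' hT' => ?_,
      hT.isBrenierMap hac1s hF1d hμF1d hfin hmem hTQ⟩
    -- The potential works on the whole space, so it restricts to `K1s`.
    · have hTK : IsSlopePotentialOn T c K1s := fun x _ y _ => hT x trivial y trivial
      exact hTK.cyclicallyMonotoneOn
    · exact hT'.ae_eq hac1s hK1s hμK1s.ae_mem hF1d hμF1d hT hfin hmem hTQ
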